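/- Let $\lambda=(\lambda_n)_{n\ge 1}$ be a frequency, i.e. a strictly increasing sequence of non-negative real numbers tending to $+\infty$. A $\lambda$-Dirichlet series is a formal series $D=\sum_n a_n e^{-\lambda_n s}$ with complex coefficients $a_n$; convergence at a point $s\in\mathbb{C}$ means convergence of the partial sums, and $\sigma_c(D)\in[-\infty,+\infty]$ denotes the infimum of all $\sigma\in\mathbb{R}$ such that $D$ converges on $[\operatorname{Re}>\sigma]$. Let $\mathcal{D}_\infty^{ext}(\lambda)$ be the space of all $\lambda$-Dirichlet series $D$ which converge at some point and whose limit function on $[\operatorname{Re}>\sigma_c(D)]$ has a holomorphic and bounded extension to $[\operatorname{Re}>0]$, i.e. there is a bounded holomorphic function $f$ on $[\operatorname{Re}>0]$ with $f(s)=D(s)$ whenever $\operatorname{Re}s>\max(0,\sigma_c(D))$; this $f$ is unique, and $\|D\|_\infty:=\sup_{\operatorname{Re}s>0}|f(s)|$. Let $\mathcal{D}_\infty(\lambda)$ be the space of all $\lambda$-Dirichlet series which converge on $[\operatorname{Re}>0]$ and define a bounded function there, with the same norm. Suppose that $\lambda$ is $\mathbb{Q}$-linearly independent. Then: 1. For every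 $D=\sum a_n e^{-\lambda_n s}\in\mathcal{D}_\infty^{ext}(\lambda)$ we have $(a_n)\in\ell_1$ and $\|(a_n)\|_1=\|D\|_\infty$. 2. $\mathcal{D}_\infty^{ext}(\lambda)=\mathcal{D}_\infty(\lambda)=\ell_1$ isometrically: the two spaces of Dirichlet series coincide, and $(a_n)\mapsto\sum a_n e^{-\lambda_n s}$ is a linear isometry of $\ell_1$ onto this space with the norm $\|\cdot\|_\infty$. 3. $\lambda$ satisfies Bohr's theorem: every $D\in\mathcal{D}_\infty^{ext}(\lambda)$ converges uniformly on $[\operatorname{Re}>\varepsilon]$ for every $\varepsilon>0$. 4. For every $D=\sum a_n e^{-\lambda_n s}\in\mathcal{D}_\infty^{ext}(\lambda)$, $$\sup_{N\in\mathbb{N}}\ \sup_{\operatorname{Re}s>0}\Big|\sum_{n=1}^{N}a_n e^{-\lambda_n s}\Big|=\|D\|_\infty .$$ -/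

import Mathlib

open Filter Topology
open scoped ENNReal

namespace GenDirichlet

/-- A frequency: a strictly increasing, non-negative real sequence tending to `+∞`
(indexed from `0`). -/
structure IsFrequency (lam : ℕ → ℝ) : Prop where
  strictMono : StrictMono lam
  nonneg : ∀ n, 0 ≤ lam n
  tendsto : Tendsto lam atTop atTop

/-- A formal `lam`-Dirichlet series `∑ a n * exp (-lam n * s)` is represented by its coefficient
sequence `a : ℕ → ℂ`.  This is the sum of its first `N` terms, as a function of `s`. -/
noncomputable def partialSum (lam : ℕ → ℝ) (a : ℕ → ℂ) (N : ℕ) (s : ℂ) : ℂ :=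
  ∑ n ∈ Finset.range N, a n * Complex.exp (-(lam n : ℂ) * s)

/-- The Dirichlet series converges (possibly conditionally) at the point `s`. -/
def ConvergesAt (lam : ℕ → ℝ) (a : ℕ → ℂ) (s : ℂ) : Prop :=
  ∃ l : ℂ, Tendsto (fun N => partialSum lam a N s) atTop (𝓝 l)

/-- The open half-plane `[Re > σ]`. -/
def halfPlane (σ : ℝ) : Set ℂ := {s : ℂ | σ < s.re}

/-- The abscissa of convergence, `+∞` if the series converges on no half-plane. -/
noncomputable def sigmaC (lam : ℕ → ℝ) (a : ℕ → ℂ) : EReal :=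
  sInf {x : EReal | ∃ σ : ℝ, x = (σ : EReal) ∧ ∀ s ∈ halfPlane σ, ConvergesAt lam a s}

/-- `f` is holomorphic and bounded on `[Re > 0]`, and extends the limit function of the series,
which lives on `[Re > sigmaC]`. -/
structure IsBoundedExtension (lam : ℕ → ℝ) (a : ℕ → ℂ) (f : ℂ → ℂ) : Prop where
  holomorphic : DifferentiableOn ℂ f (halfPlane 0)
  bounded : ∃ C : ℝ, ∀ s ∈ halfPlane 0, ‖f s‖ ≤ C
  extends_limit : ∀ s ∈ halfPlane 0, sigmaC lam a < (s.re : EReal) →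
    Tendsto (fun N => partialSum lam a N s) atTop (𝓝 (f s))

/-- The space of all somewhere convergent `lam`-Dirichlet series which allow a holomorphic and
bounded extension to `[Re > 0]`. -/
def DInfExt (lam : ℕ → ℝ) : Set (ℕ → ℂ) :=
  {a | (∃ s : ℂ, ConvergesAt lam a s) ∧ ∃ f : ℂ → ℂ, IsBoundedExtension lam a f}

/-- The space of all `lam`-Dirichlet series which converge on `[Re > 0]` and define a bounded
function there. -/
def DInf (lam : ℕ → ℝ) : Set (ℕ → ℂ) :=
  {a | ∃ C : ℝ, ∀ s ∈ halfPlane 0,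
    ∃ l : ℂ, Tendsto (fun N => partialSum lam a N s) atTop (𝓝 l) ∧ ‖l‖ ≤ C}

/-- `sup_{Re s > 0} |g s|`, as an extended non-negative real. -/
noncomputable def supNorm (g : ℂ → ℂ) : ℝ≥0∞ :=
  ⨆ s ∈ halfPlane 0, ‖g s‖ₑ

/-- The norm `‖D‖_∞ = sup_{Re s > 0} |f s|`, where `f` is the holomorphic bounded extension of `D`.
The extension is unique on `[Re > 0]`, so the supremum over `f` ranges over a single value. -/
noncomputable def seriesNorm (lam : ℕ → ℝ) (a : ℕ → ℂ) : ℝ≥0∞ :=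
  ⨆ (f : ℂ → ℂ) (_ : IsBoundedExtension lam a f), supNorm f

/-- `lam` satisfies Bohr's theorem: every series in `DInfExt lam` converges uniformly on
`[Re > ε]` for all `ε > 0`. -/
def SatisfiesBohr (lam : ℕ → ℝ) : Prop :=
  ∀ a ∈ DInfExt lam, ∀ ε : ℝ, 0 < ε →
    ∃ g : ℂ → ℂ, TendstoUniformlyOn (partialSum lam a) g atTop (halfPlane ε)

end GenDirichlet

namespace GenDirichlet

/-! The extension `f`, bounded by M, is tested against nonnegative trigonometric polynomials on a
line Re s = σ > 0. Its mean there against e^{iμt} is a_n e^{-λ_n σ} if μ = λ_n, and 0 if μ is no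
frequency (`IsBoundedExtension.tendsto_symmMean`). This needs no convergence on the line: by
Phragmén–Lindelöf, `f` minus its N-th partial sum is O(e^{-λ_N Re s}) on all of [Re > 0]
(`exists_remainder_bound`), and Cauchy's theorem then bounds the vertical integrals.

Let P = |Q|², where Q is a sum of unimodular exponentials with frequencies Σ_{n<N} j_n λ_n, 0 ≤ j_n
≤ K. By independence these (K+1)^N frequencies are distinct, so P has mean (K+1)^N; and λ_n is the
difference of two of them only along j ↦ j + e_n, which stays in the cube for K(K+1)^{N-1} points j
when n < N. With phases cancelling arg a_n, the mean of fP is Σ_{n<N} K(K+1)^{N-1} |a_n| e^{-λ_n σ},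
and it is at most M(K+1)^N (`norm_sum_coeff_le`). Letting K → ∞ and then σ → 0 gives Σ|a_n| ≤ M. The
rest follows from this bound and the triangle inequality. -/

/-! ### Abel summation and half-planes of convergence -/

theorem norm_exp_sub_exp_le {w : ℂ} (hw : 0 < w.re) {a b : ℝ} (hab : a ≤ b) :
    ‖Complex.exp (-(a : ℂ) * w) - Complex.exp (-(b : ℂ) * w)‖ ≤
      ‖w‖ / w.re * (Real.exp (-a * w.re) - Real.exp (-b * w.re)) := by
  have hder : ∀ x : ℝ, HasDerivAt
      (fun x : ℝ => Complex.exp (-(a : ℂ) * w) - Complex.exp (-(x : ℂ) * w))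
      (w * Complex.exp (-(x : ℂ) * w)) x := by
    intro x
    have h1 : HasDerivAt (fun z : ℂ => Complex.exp (-(a : ℂ) * w) - Complex.exp (-z * w))
        (w * Complex.exp (-(x : ℂ) * w)) (x : ℂ) := by
      have := (((hasDerivAt_id (x : ℂ)).neg.mul_const w).cexp).const_sub
        (Complex.exp (-(a : ℂ) * w))
      refine this.congr_deriv ?_
      simp [mul_comm]
    exact h1.comp_ofReal
  have hB : ∀ x : ℝ, HasDerivAt
      (fun x : ℝ => ‖w‖ / w.re * (Real.exp (-a * w.re) - Real.exp (-x * w.re)))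
      (‖w‖ * Real.exp (-x * w.re)) x := by
    intro x
    have := ((((hasDerivAt_id x).neg.mul_const w.re).exp).const_sub
        (Real.exp (-a * w.re))).const_mul (‖w‖ / w.re)
    refine this.congr_deriv ?_
    simp only [Pi.neg_apply, id]
    field_simp
  -- The bound is the integral of ‖w e^{-xw}‖ over [a, b], obtained by comparing derivatives.
  refine image_norm_le_of_norm_deriv_right_le_deriv_boundary (a := a) (b := b)
    (fun x _ => (hder x).continuousAt.continuousWithinAt)
    (fun x _ => (hder x).hasDerivWithinAt) (by simp) hB ?_ ⟨hab, le_rfl⟩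
  intro x _
  rw [norm_mul, Complex.norm_exp]
  simp

theorem partialSum_succ (lam : ℕ → ℝ) (a : ℕ → ℂ) (N : ℕ) (s : ℂ) :
    partialSum lam a (N + 1) s =
      partialSum lam a N s + a N * Complex.exp (-(lam N : ℂ) * s) :=
  Finset.sum_range_succ _ _

theorem differentiable_partialSum (lam : ℕ → ℝ) (a : ℕ → ℂ) (N : ℕ) :
    Differentiable ℂ (partialSum lam a N) := by
  unfold partialSum
  fun_prop

theorem norm_term_le {lam : ℕ → ℝ} (hlam : IsFrequency lam) (a : ℕ → ℂ) (n : ℕ) {s : ℂ}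
    (hs : s ∈ halfPlane 0) : ‖a n * Complex.exp (-(lam n : ℂ) * s)‖ ≤ ‖a n‖ := by
  rw [norm_mul, Complex.norm_exp]
  refine mul_le_of_le_one_right (norm_nonneg _) (Real.exp_le_one_iff.2 ?_)
  have hs' : 0 < s.re := hs
  simp only [Complex.mul_re, Complex.neg_re, Complex.ofReal_re, Complex.neg_im,
    Complex.ofReal_im, neg_zero, zero_mul, sub_zero]
  nlinarith [hlam.nonneg n]

/-- Abel summation: if the partial sums at `s₀` are bounded, then the series converges on
`[Re > Re s₀]` at a rate which is uniform on angular sectors with vertex `s₀`. -/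
theorem norm_partialSum_sub_le {lam : ℕ → ℝ} (hlam : Monotone lam) {a : ℕ → ℂ} {s₀ s : ℂ}
    (hs : s₀.re < s.re) {C : ℝ} (hC : ∀ j, ‖partialSum lam a j s₀‖ ≤ C) {k m : ℕ} (hkm : k ≤ m) :
    ‖partialSum lam a m s - partialSum lam a k s‖ ≤
      2 * C * (1 + ‖s - s₀‖ / (s - s₀).re) * Real.exp (-lam k * (s - s₀).re) := by
  set w := s - s₀ with hwdef
  have hw : 0 < w.re := by simp [hwdef, hs]
  have hC0 : 0 ≤ C := (norm_nonneg _).trans (hC 0)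
  have hU : ∀ j, ‖partialSum lam a j s₀ - partialSum lam a k s₀‖ ≤ 2 * C := fun j =>
    (norm_sub_le _ _).trans (by linarith [hC j, hC k])
  have hq : 0 ≤ ‖w‖ / w.re := by positivity
  -- With the Abel boundary term subtracted, each induction step adds one difference of
  -- exponentials, and the bounds telescope.
  have key : ‖partialSum lam a m s - partialSum lam a k s -
      (partialSum lam a m s₀ - partialSum lam a k s₀) * Complex.exp (-(lam m : ℂ) * w)‖ ≤
      2 * C * (‖w‖ / w.re * (Real.exp (-lam k * w.re) - Real.exp (-lam m * w.re))) := by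
    induction m, hkm using Nat.le_induction with
    | base => simp
    | succ m hm ih =>
      have hexp : Complex.exp (-(lam m : ℂ) * s) =
          Complex.exp (-(lam m : ℂ) * s₀) * Complex.exp (-(lam m : ℂ) * w) := by
        rw [← Complex.exp_add]; congr 1; rw [hwdef]; ring
      have hstep : partialSum lam a (m + 1) s - partialSum lam a k s -
          (partialSum lam a (m + 1) s₀ - partialSum lam a k s₀) *
            Complex.exp (-(lam (m + 1) : ℂ) * w) =
          (partialSum lam a m s - partialSum lam a k s -
            (partialSum lam a m s₀ - partialSum lam a k s₀) * Complex.exp (-(lam m : ℂ) * w)) +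
          (partialSum lam a (m + 1) s₀ - partialSum lam a k s₀) *
            (Complex.exp (-(lam m : ℂ) * w) - Complex.exp (-(lam (m + 1) : ℂ) * w)) := by
        rw [partialSum_succ, partialSum_succ, hexp]; ring
      rw [hstep]
      refine (norm_add_le _ _).trans ?_
      rw [norm_mul]
      have h1 := mul_le_mul (hU (m + 1)) (norm_exp_sub_exp_le hw (hlam m.le_succ))
        (norm_nonneg _) (by positivity)
      refine (add_le_add ih h1).trans (le_of_eq ?_)
      simp only [Nat.succ_eq_add_one]
      ring
  have h2 : ‖(partialSum lam a m s₀ - partialSum lam a k s₀) * Complex.exp (-(lam m : ℂ) * w)‖ ≤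
      2 * C * Real.exp (-lam m * w.re) := by
    rw [norm_mul, Complex.norm_exp]
    have : (-(lam m : ℂ) * w).re = -lam m * w.re := by simp
    rw [this]
    gcongr
    exact hU m
  have h3 : Real.exp (-lam m * w.re) ≤ Real.exp (-lam k * w.re) := by
    apply Real.exp_le_exp.2
    nlinarith [hlam hkm]
  have h4 : 0 < Real.exp (-lam m * w.re) := Real.exp_pos _
  have h5 := norm_sub_norm_le (partialSum lam a m s - partialSum lam a k s)
    ((partialSum lam a m s₀ - partialSum lam a k s₀) * Complex.exp (-(lam m : ℂ) * w))
  calc _ ≤ 2 * C * Real.exp (-lam m * w.re) +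
        2 * C * (‖w‖ / w.re * (Real.exp (-lam k * w.re) - Real.exp (-lam m * w.re))) := by linarith
    _ ≤ 2 * C * Real.exp (-lam k * w.re) +
        2 * C * (‖w‖ / w.re * Real.exp (-lam k * w.re)) := by
      gcongr
      linarith
    _ = _ := by ring

theorem ConvergesAt.exists_bound {lam : ℕ → ℝ} {a : ℕ → ℂ} {s : ℂ} (h : ConvergesAt lam a s) :
    ∃ C, ∀ j, ‖partialSum lam a j s‖ ≤ C := by
  obtain ⟨l, hl⟩ := h
  obtain ⟨C, hC⟩ := hl.norm.bddAbove_range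
  exact ⟨C, fun j => hC ⟨j, rfl⟩⟩

theorem tendsto_exp_neg_lam_mul {lam : ℕ → ℝ} (hlam : IsFrequency lam) {x : ℝ} (hx : 0 < x) :
    Tendsto (fun k => Real.exp (-lam k * x)) atTop (𝓝 0) := by
  refine Real.tendsto_exp_atBot.comp ?_
  exact (tendsto_neg_atTop_atBot.comp hlam.tendsto).atBot_mul_const hx

theorem ConvergesAt.of_re_lt {lam : ℕ → ℝ} (hlam : IsFrequency lam) {a : ℕ → ℂ} {s₀ s : ℂ}
    (h : ConvergesAt lam a s₀) (hs : s₀.re < s.re) : ConvergesAt lam a s := by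
  obtain ⟨C, hC⟩ := h.exists_bound
  refine cauchySeq_tendsto_of_complete (cauchySeq_of_le_tendsto_0' (fun k =>
    2 * C * (1 + ‖s - s₀‖ / (s - s₀).re) * Real.exp (-lam k * (s - s₀).re)) ?_ ?_)
  · intro k m hkm
    rw [dist_comm, dist_eq_norm]
    exact norm_partialSum_sub_le hlam.strictMono.monotone hs hC hkm
  · simpa using (tendsto_exp_neg_lam_mul hlam (x := (s - s₀).re) (by simpa using hs)).const_mul
      (2 * C * (1 + ‖s - s₀‖ / (s - s₀).re))

theorem isOpen_halfPlane (σ : ℝ) : IsOpen (halfPlane σ) :=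
  isOpen_lt continuous_const Complex.continuous_re

/-- The limit function of a Dirichlet series is holomorphic on its half-plane of convergence. -/
theorem differentiableOn_of_tendsto {lam : ℕ → ℝ} (hlam : IsFrequency lam) {a : ℕ → ℂ}
    {f : ℂ → ℂ} {σ : ℝ}
    (h : ∀ s ∈ halfPlane σ, Tendsto (fun N => partialSum lam a N s) atTop (𝓝 (f s))) :
    DifferentiableOn ℂ f (halfPlane σ) := by
  refine TendstoLocallyUniformlyOn.differentiableOn (φ := atTop) (F := partialSum lam a) ?_
    (Eventually.of_forall fun N => (differentiable_partialSum lam a N).differentiableOn)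
    (isOpen_halfPlane σ)
  rw [Metric.tendstoLocallyUniformlyOn_iff]
  intro ε hε z hz
  have hz' : σ < z.re := hz
  -- The vertex `x` lies strictly left of `y`, so ‖s - x‖ / Re(s - x) stays bounded for `s` near `z`
  -- with Re s > `y`.
  obtain ⟨x, hx1, hx2⟩ := exists_between hz'
  obtain ⟨y, hy1, hy2⟩ := exists_between hx2
  have hconv : ConvergesAt lam a (x : ℂ) := ⟨_, h x (by simpa [halfPlane] using hx1)⟩
  obtain ⟨C, hC⟩ := hconv.exists_bound
  have hC0 : 0 ≤ C := (norm_nonneg _).trans (hC 0)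
  set D := 2 * C * (1 + (‖z - x‖ + 1) / (y - x)) with hD
  have hyx : 0 < y - x := by linarith
  refine ⟨halfPlane y ∩ Metric.ball z 1, mem_nhdsWithin_of_mem_nhds
    (inter_mem ((isOpen_halfPlane y).mem_nhds hy2) (Metric.ball_mem_nhds z one_pos)), ?_⟩
  have hlim : Tendsto (fun k => D * Real.exp (-lam k * (y - x))) atTop (𝓝 0) := by
    simpa using (tendsto_exp_neg_lam_mul hlam hyx).const_mul D
  filter_upwards [hlim.eventually (gt_mem_nhds hε)] with k hk s hs
  have hsy : y < s.re := hs.1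
  have hsz : ‖s - z‖ < 1 := by simpa [dist_eq_norm] using hs.2
  have hbound : ‖f s - partialSum lam a k s‖ ≤
      2 * C * (1 + ‖s - x‖ / (s - x).re) * Real.exp (-lam k * (s - x).re) := by
    refine le_of_tendsto ((h s (hx1.trans (hy1.trans hsy))).sub_const _).norm ?_
    filter_upwards [eventually_ge_atTop k] with m hm
    exact norm_partialSum_sub_le hlam.strictMono.monotone (by simp; linarith) hC hm
  rw [dist_eq_norm]
  refine lt_of_le_of_lt (hbound.trans ?_) hk
  have h1 : y - x ≤ (s - x).re := by simp; linarith
  have h2 : ‖s - x‖ ≤ ‖z - x‖ + 1 := by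
    have : s - x = (z - x) + (s - z) := by ring
    rw [this]
    exact (norm_add_le _ _).trans (by linarith)
  have h3 : Real.exp (-lam k * (s - x).re) ≤ Real.exp (-lam k * (y - x)) := by
    apply Real.exp_le_exp.2
    nlinarith [hlam.nonneg k]
  rw [hD]
  gcongr

/-! ### Decay of remainders by Phragmén–Lindelöf -/

/-- The remainder of a Dirichlet series with a bounded extension decays like its first term, on the
whole right half-plane. -/
theorem IsBoundedExtension.exists_remainder_bound {lam : ℕ → ℝ} (hlam : IsFrequency lam)
    {a : ℕ → ℂ} {f : ℂ → ℂ} (hf : IsBoundedExtension lam a f) {s₀ : ℂ}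
    (hs₀ : ConvergesAt lam a s₀) (N : ℕ) :
    ∃ B, ∀ s ∈ halfPlane 0,
      ‖f s - partialSum lam a N s‖ ≤ B * Real.exp (-lam N * s.re) := by
  obtain ⟨M, hM⟩ := hf.bounded
  obtain ⟨C, hC⟩ := hs₀.exists_bound
  have hC0 : 0 ≤ C := (norm_nonneg _).trans (hC 0)
  set B := M + ∑ n ∈ Finset.range N, ‖a n‖ with hB
  have hR : ∀ s ∈ halfPlane 0, ‖f s - partialSum lam a N s‖ ≤ B := by
    intro s hs
    refine (norm_sub_le _ _).trans (add_le_add (hM s hs) ?_)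
    exact norm_sum_le_of_le _ fun n _ => norm_term_le hlam a n hs
  have hB0 : 0 ≤ B := (norm_nonneg _).trans (hR 1 (by simp [halfPlane]))
  have hsig : sigmaC lam a ≤ (s₀.re : EReal) :=
    sInf_le ⟨s₀.re, rfl, fun s hs => hs₀.of_re_lt hlam hs⟩
  set h : ℂ → ℂ := fun s => (f s - partialSum lam a N s) * Complex.exp (lam N * s) with hh
  have hnorm : ∀ s, ‖h s‖ = ‖f s - partialSum lam a N s‖ * Real.exp (lam N * s.re) := by
    intro s
    rw [hh]
    simp only [norm_mul, Complex.norm_exp]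
    simp
  have hdiff : DifferentiableOn ℂ h (halfPlane 0) := by
    refine DifferentiableOn.mul (hf.holomorphic.sub
      (differentiable_partialSum lam a N).differentiableOn) ?_
    fun_prop
  -- Far out on the real axis, the decay in the Abel estimate cancels the factor e^{λ_N x}.
  have hreal : ∀ x : ℝ, 0 < x → s₀.re + 1 ≤ x → ‖h x‖ ≤
      2 * C * (2 + |s₀.im|) * Real.exp (lam N * s₀.re) := by
    intro x hx0 hx1
    have hlt : s₀.re < (x : ℂ).re := by simp; linarith
    have hb : ‖f x - partialSum lam a N x‖ ≤
        2 * C * (1 + ‖(x : ℂ) - s₀‖ / ((x : ℂ) - s₀).re) *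
          Real.exp (-lam N * ((x : ℂ) - s₀).re) := by
      refine le_of_tendsto ((hf.extends_limit x (by simpa [halfPlane] using hx0)
        (hsig.trans_lt (by exact_mod_cast hlt))).sub_const _).norm ?_
      filter_upwards [eventually_ge_atTop N] with m hm
      exact norm_partialSum_sub_le hlam.strictMono.monotone hlt hC hm
    have hre : ((x : ℂ) - s₀).re = x - s₀.re := by simp
    have hw : ‖(x : ℂ) - s₀‖ / ((x : ℂ) - s₀).re ≤ 1 + |s₀.im| := by
      rw [hre, div_le_iff₀ (by linarith)]
      refine (Complex.norm_le_abs_re_add_abs_im _).trans ?_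
      rw [hre]
      simp only [Complex.sub_im, Complex.ofReal_im, zero_sub, abs_neg]
      rw [abs_of_pos (by linarith)]
      nlinarith [abs_nonneg s₀.im]
    rw [hnorm]
    calc _ ≤ 2 * C * (1 + ‖(x : ℂ) - s₀‖ / ((x : ℂ) - s₀).re) *
          Real.exp (-lam N * ((x : ℂ) - s₀).re) * Real.exp (lam N * (x : ℂ).re) := by gcongr
      _ = 2 * C * (1 + ‖(x : ℂ) - s₀‖ / ((x : ℂ) - s₀).re) * Real.exp (lam N * s₀.re) := by
        rw [mul_assoc _ (Real.exp _), ← Real.exp_add]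
        congr 2
        simp; ring
      _ ≤ 2 * C * (1 + (1 + |s₀.im|)) * Real.exp (lam N * s₀.re) := by gcongr
      _ = _ := by ring
  -- `h` has exponential type and is bounded on the far real axis, so Phragmén–Lindelöf carries the
  -- bound from the boundary line inwards. The shift by `ε` is needed because `f` is controlled only
  -- on the open half-plane; `ε` tends to 0 below.
  have hPL : ∀ ε : ℝ, 0 < ε → ∀ z : ℂ, 0 ≤ z.re → ‖h (z + ε)‖ ≤ B * Real.exp (lam N * ε) := by
    intro ε hε z hz
    have hmaps : ∀ z : ℂ, 0 ≤ z.re → z + ε ∈ halfPlane 0 := by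
      intro z hz
      simp only [halfPlane, Set.mem_ofPred_eq, Complex.add_re, Complex.ofReal_re]
      linarith
    refine PhragmenLindelof.right_half_plane_of_bounded_on_real (f := fun z => h (z + ε))
      ?_ ?_ ?_ ?_ hz
    · apply DifferentiableOn.diffContOnCl
      refine hdiff.comp (t := halfPlane 0) (by fun_prop) ?_
      intro z hz
      rw [Complex.closure_setOfPred_lt_re] at hz
      exact hmaps z hz
    · refine ⟨1, one_lt_two, lam N, Asymptotics.IsBigO.of_bound (B * Real.exp (lam N * ε)) ?_⟩
      filter_upwards [mem_inf_of_right (mem_principal_self _)] with z hz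
      have hz' : 0 < z.re := hz
      rw [hnorm, Real.norm_of_nonneg (Real.exp_pos _).le, mul_assoc, ← Real.exp_add]
      refine mul_le_mul (hR _ (hmaps z hz'.le)) (Real.exp_le_exp.2 ?_) (Real.exp_pos _).le hB0
      have := Complex.re_le_norm z
      simp only [Complex.add_re, Complex.ofReal_re, Real.rpow_one]
      nlinarith [hlam.nonneg N]
    · refine ⟨2 * C * (2 + |s₀.im|) * Real.exp (lam N * s₀.re), ?_⟩
      rw [eventually_map]
      filter_upwards [eventually_gt_atTop 0, eventually_ge_atTop (s₀.re + 1)] with x h1 h2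
      have := hreal (x + ε) (by linarith) (by linarith)
      push_cast at this
      exact this
    · intro x
      rw [hnorm]
      refine mul_le_mul (hR _ (hmaps _ (by simp))) (by simp) (Real.exp_pos _).le hB0
  refine ⟨B, fun s hs => ?_⟩
  have hs' : 0 < s.re := hs
  have hle : ‖h s‖ ≤ B := by
    have ht : Tendsto (fun ε : ℝ => B * Real.exp (lam N * ε)) (𝓝[>] 0) (𝓝 B) := by
      have : Continuous (fun ε : ℝ => B * Real.exp (lam N * ε)) := by fun_prop
      simpa using (this.tendsto 0).mono_left nhdsWithin_le_nhds
    refine ge_of_tendsto ht ?_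
    filter_upwards [Ioo_mem_nhdsGT hs'] with ε hε
    have := hPL ε hε.1 (s - ε) (by simp; exact hε.2.le)
    simpa using this
  rw [hnorm] at hle
  rw [neg_mul, Real.exp_neg, ← div_eq_mul_inv, le_div_iff₀ (Real.exp_pos _)]
  exact hle

/-! ### Means along vertical lines and Bohr coefficients -/

/-- The mean of `g` over the symmetric interval `[-T, T]`. -/
noncomputable def symmMean (g : ℝ → ℂ) (T : ℝ) : ℂ :=
  (2 * T : ℂ)⁻¹ * ∫ t in -T..T, g t

theorem tendsto_symmMean_zero {g : ℝ → ℂ} {C : ℝ}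
    (h : ∀ T : ℝ, 0 < T → ‖∫ t in -T..T, g t‖ ≤ C) :
    Tendsto (symmMean g) atTop (𝓝 0) := by
  have hlim : Tendsto (fun T : ℝ => (2 * T)⁻¹ * C) atTop (𝓝 0) := by
    have : Tendsto (fun T : ℝ => (2 * T)⁻¹) atTop (𝓝 0) :=
      tendsto_inv_atTop_zero.comp (tendsto_id.const_mul_atTop two_pos)
    simpa using this.mul_const C
  refine squeeze_zero_norm' ?_ hlim
  filter_upwards [eventually_gt_atTop 0] with T hT
  rw [symmMean, norm_mul, norm_inv]
  have : ‖(2 * T : ℂ)‖ = 2 * T := by simp [abs_of_pos hT]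
  rw [this]
  gcongr
  exact h T hT

theorem symmMean_const_mul (c : ℂ) (g : ℝ → ℂ) (T : ℝ) :
    symmMean (fun t => c * g t) T = c * symmMean g T := by
  simp only [symmMean, intervalIntegral.integral_const_mul]
  ring

theorem symmMean_add {g h : ℝ → ℂ} (hg : Continuous g) (hh : Continuous h) (T : ℝ) :
    symmMean (fun t => g t + h t) T = symmMean g T + symmMean h T := by
  simp only [symmMean]
  rw [intervalIntegral.integral_add (hg.intervalIntegrable _ _) (hh.intervalIntegrable _ _)]
  ring

theorem symmMean_sum {ι : Type*} (S : Finset ι) {g : ι → ℝ → ℂ} (hg : ∀ i, Continuous (g i))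
    (T : ℝ) : symmMean (fun t => ∑ i ∈ S, g i t) T = ∑ i ∈ S, symmMean (g i) T := by
  simp only [symmMean]
  rw [intervalIntegral.integral_finsetSum fun i _ => (hg i).intervalIntegrable _ _,
    Finset.mul_sum]

theorem tendsto_symmMean_exp (μ : ℝ) :
    Tendsto (symmMean fun t => Complex.exp (Complex.I * μ * t)) atTop
      (𝓝 (if μ = 0 then 1 else 0)) := by
  split_ifs with hμ
  · refine tendsto_const_nhds.congr' ?_
    filter_upwards [eventually_gt_atTop 0] with T hT
    have : (T : ℂ) ≠ 0 := by exact_mod_cast hT.ne'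
    simp only [symmMean, hμ, Complex.ofReal_zero, mul_zero, zero_mul, Complex.exp_zero,
      intervalIntegral.integral_const, Complex.real_smul, mul_one]
    push_cast
    field_simp
    ring
  · have hne : Complex.I * (μ : ℂ) ≠ 0 := by simpa using hμ
    refine tendsto_symmMean_zero (C := 2 / |μ|) fun T _ => ?_
    rw [integral_exp_mul_complex hne, norm_div]
    have hden : ‖Complex.I * (μ : ℂ)‖ = |μ| := by simp
    rw [hden]
    gcongr
    refine (norm_sub_le _ _).trans ?_
    simp only [Complex.norm_exp]
    simp
    norm_num

/-- A holomorphic function decaying exponentially in `Re s` has bounded integrals along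
vertical segments. -/
theorem norm_integral_vertical_le {h : ℂ → ℂ} (hd : DifferentiableOn ℂ h (halfPlane 0))
    {B δ : ℝ} (hδ : 0 < δ) (hB : ∀ s ∈ halfPlane 0, ‖h s‖ ≤ B * Real.exp (-δ * s.re))
    {σ : ℝ} (hσ : 0 < σ) {T : ℝ} (hT : 0 < T) :
    ‖∫ t in -T..T, h (σ + t * Complex.I)‖ ≤ 2 * (B / δ) := by
  have hB0 : 0 ≤ B := by
    have := (norm_nonneg _).trans (hB 1 (by simp [halfPlane]))
    exact nonneg_of_mul_nonneg_left this (Real.exp_pos _)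
  have hmem : ∀ x y : ℝ, 0 < x → (x + y * Complex.I : ℂ) ∈ halfPlane 0 := by
    intro x y hx
    simpa [halfPlane] using hx
  have hhor : ∀ (ρ y : ℝ), σ ≤ ρ → ‖∫ x in σ..ρ, h (x + y * Complex.I)‖ ≤ B / δ := by
    intro ρ y hρ
    have hder : ∀ x : ℝ, HasDerivAt (fun x => -(B / δ) * Real.exp (-δ * x))
        (B * Real.exp (-δ * x)) x := by
      intro x
      refine ((((hasDerivAt_id x).const_mul (-δ)).exp).const_mul (-(B / δ))).congr_deriv ?_
      simp only [id]
      field_simp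
    have hint : ∫ x in σ..ρ, B * Real.exp (-δ * x) =
        -(B / δ) * Real.exp (-δ * ρ) - -(B / δ) * Real.exp (-δ * σ) :=
      intervalIntegral.integral_eq_sub_of_hasDerivAt (fun x _ => hder x)
        (Continuous.intervalIntegrable (by fun_prop) _ _)
    have hle : ‖∫ x in σ..ρ, h (x + y * Complex.I)‖ ≤ ∫ x in σ..ρ, B * Real.exp (-δ * x) := by
      refine intervalIntegral.norm_integral_le_of_norm_le hρ ?_
        (Continuous.intervalIntegrable (by fun_prop) _ _)
      refine Eventually.of_forall fun x hx => ?_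
      simpa using hB _ (hmem x y (hσ.trans hx.1))
    have h1 : Real.exp (-δ * σ) ≤ 1 := Real.exp_le_one_iff.2 (by nlinarith)
    have h2 := Real.exp_pos (-δ * ρ)
    have h3 : 0 ≤ B / δ := by positivity
    rw [hint] at hle
    nlinarith
  -- Cauchy's theorem on [σ, ρ] × [-T, T]: each horizontal side costs at most B/δ whatever T is, and
  -- the far side vanishes as ρ → ∞.
  have hbound : ∀ ρ : ℝ, σ ≤ ρ → ‖∫ t in -T..T, h (σ + t * Complex.I)‖ ≤
      2 * (B / δ) + B * Real.exp (-δ * ρ) * (2 * T) := by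
    intro ρ hρ
    have hrect := Complex.integral_boundary_rect_eq_zero_of_differentiableOn h ⟨σ, -T⟩ ⟨ρ, T⟩
      (hd.mono ?_)
    · simp only [smul_eq_mul] at hrect
      have heq : Complex.I * (∫ t in -T..T, h (σ + t * Complex.I)) =
          ((∫ x in σ..ρ, h (x + (-T : ℝ) * Complex.I)) -
            ∫ x in σ..ρ, h (x + (T : ℝ) * Complex.I)) +
          Complex.I * ∫ t in -T..T, h (ρ + t * Complex.I) := (sub_eq_zero.1 hrect).symm
      have hn : ‖∫ t in -T..T, h (σ + t * Complex.I)‖ =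
          ‖Complex.I * (∫ t in -T..T, h (σ + t * Complex.I))‖ := by simp
      have hv : ‖∫ t in -T..T, h (ρ + t * Complex.I)‖ ≤ B * Real.exp (-δ * ρ) * |T - -T| := by
        refine intervalIntegral.norm_integral_le_of_norm_le_const fun t _ => ?_
        simpa using hB _ (hmem ρ t (hσ.trans_le hρ))
      have habs : |T - -T| = 2 * T := by rw [abs_of_pos (by linarith)]; ring
      rw [habs] at hv
      rw [hn, heq]
      refine (norm_add_le _ _).trans ?_
      refine add_le_add ((norm_sub_le _ _).trans ?_) (by simpa using hv)
      linarith [hhor ρ (-T) hρ, hhor ρ T hρ]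
    · intro z hz
      have := hz.1
      simp only [Set.mem_preimage, Set.uIcc_of_le hρ] at this
      exact hσ.trans_le this.1
  have hlim : Tendsto (fun ρ : ℝ => 2 * (B / δ) + B * Real.exp (-δ * ρ) * (2 * T)) atTop
      (𝓝 (2 * (B / δ))) := by
    have : Tendsto (fun ρ : ℝ => Real.exp (-δ * ρ)) atTop (𝓝 0) :=
      Real.tendsto_exp_atBot.comp (tendsto_id.const_mul_atTop_of_neg (by linarith))
    simpa using ((this.const_mul B).mul_const (2 * T)).const_add (2 * (B / δ))
  refine ge_of_tendsto hlim ?_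
  filter_upwards [eventually_ge_atTop σ] with ρ hρ using hbound ρ hρ

theorem continuous_vertical {f : ℂ → ℂ} (hf : DifferentiableOn ℂ f (halfPlane 0)) {σ : ℝ}
    (hσ : 0 < σ) : Continuous fun t : ℝ => f (σ + t * Complex.I) := by
  refine hf.continuousOn.comp_continuous (by fun_prop) fun t => ?_
  simpa [halfPlane] using hσ

/-- The Bohr coefficients of the bounded extension along a vertical line. -/
theorem IsBoundedExtension.tendsto_symmMean {lam : ℕ → ℝ} (hlam : IsFrequency lam)
    {a : ℕ → ℂ} {f : ℂ → ℂ} (hf : IsBoundedExtension lam a f) {s₀ : ℂ}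
    (hs₀ : ConvergesAt lam a s₀) {σ : ℝ} (hσ : 0 < σ) {μ : ℝ} {N : ℕ} (hN : μ < lam N) :
    Tendsto (symmMean fun t => f (σ + t * Complex.I) * Complex.exp (Complex.I * μ * t)) atTop
      (𝓝 (∑ n ∈ Finset.range N,
        if lam n = μ then a n * (Real.exp (-lam n * σ) : ℂ) else 0)) := by
  obtain ⟨B, hB⟩ := hf.exists_remainder_bound hlam hs₀ N
  -- The remainder still decays, at rate λ_N - μ > 0, after multiplication by e^{μs}. On the line
  -- this factor is e^{iμt} up to the constant e^{μσ}, so the remainder contributes nothing to the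
  -- mean.
  set h : ℂ → ℂ := fun s => (f s - partialSum lam a N s) * Complex.exp (μ * s) with hh
  have hdiff : DifferentiableOn ℂ h (halfPlane 0) := by
    refine DifferentiableOn.mul (hf.holomorphic.sub
      (differentiable_partialSum lam a N).differentiableOn) ?_
    fun_prop
  have hbd : ∀ s ∈ halfPlane 0, ‖h s‖ ≤ B * Real.exp (-(lam N - μ) * s.re) := by
    intro s hs
    have h1 : ‖h s‖ = ‖f s - partialSum lam a N s‖ * Real.exp (μ * s.re) := by
      simp only [hh, norm_mul, Complex.norm_exp]
      simp
    rw [h1]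
    calc _ ≤ B * Real.exp (-lam N * s.re) * Real.exp (μ * s.re) := by gcongr; exact hB s hs
      _ = _ := by rw [mul_assoc, ← Real.exp_add]; congr 2; ring
  have hrem : Tendsto (symmMean fun t => h (σ + t * Complex.I)) atTop (𝓝 0) :=
    tendsto_symmMean_zero fun T hT =>
      norm_integral_vertical_le hdiff (sub_pos.2 hN) hbd hσ hT
  have hdecomp : ∀ t : ℝ, f (σ + t * Complex.I) * Complex.exp (Complex.I * μ * t) =
      (∑ n ∈ Finset.range N, a n * (Real.exp (-lam n * σ) : ℂ) *
        Complex.exp (Complex.I * (μ - lam n : ℝ) * t)) +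
      Complex.exp (-μ * σ) * h (σ + t * Complex.I) := by
    intro t
    have e1 : Complex.exp (-μ * σ) * Complex.exp (μ * (σ + t * Complex.I)) =
        Complex.exp (Complex.I * μ * t) := by
      rw [← Complex.exp_add]; congr 1; ring
    have e2 : partialSum lam a N (σ + t * Complex.I) * Complex.exp (Complex.I * μ * t) =
        ∑ n ∈ Finset.range N, a n * (Real.exp (-lam n * σ) : ℂ) *
          Complex.exp (Complex.I * (μ - lam n : ℝ) * t) := by
      rw [partialSum, Finset.sum_mul]
      refine Finset.sum_congr rfl fun n _ => ?_
      push_cast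
      rw [mul_assoc (a n), mul_assoc (a n), ← Complex.exp_add, ← Complex.exp_add]
      congr 2
      ring
    rw [← e2, hh, ← e1]
    ring
  have hcont : Continuous fun t : ℝ => Complex.exp (-μ * σ) * h (σ + t * Complex.I) :=
    continuous_const.mul (continuous_vertical hdiff hσ)
  have hmean : ∀ T, symmMean
      (fun t => f (σ + t * Complex.I) * Complex.exp (Complex.I * μ * t)) T =
      (∑ n ∈ Finset.range N, a n * (Real.exp (-lam n * σ) : ℂ) *
        symmMean (fun t => Complex.exp (Complex.I * (μ - lam n : ℝ) * t)) T) +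
      Complex.exp (-μ * σ) * symmMean (fun t => h (σ + t * Complex.I)) T := by
    intro T
    rw [funext hdecomp, symmMean_add (by fun_prop) hcont,
      symmMean_sum _ (fun n => by fun_prop), symmMean_const_mul]
    simp only [symmMean_const_mul]
  rw [show symmMean (fun t => f (σ + t * Complex.I) * Complex.exp (Complex.I * μ * t)) = _ from
    funext hmean]
  have hlim := (tendsto_finsetSum (Finset.range N) fun n _ =>
    (tendsto_symmMean_exp (μ - lam n)).const_mul (a n * (Real.exp (-lam n * σ) : ℂ))).add
    (hrem.const_mul (Complex.exp (-μ * σ)))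
  convert hlim using 2
  rw [mul_zero, add_zero]
  refine Finset.sum_congr rfl fun n _ => ?_
  by_cases hn : lam n = μ
  · simp [hn]
  · simp [hn, sub_eq_zero, Ne.symm hn]

/-! ### Testing against nonnegative trigonometric polynomials -/

/-- Since `P` is nonnegative, the mean of its modulus is the modulus of its mean, which can be read
off from its constant term. -/
theorem norm_symmMean_mul_le {φ P : ℝ → ℂ} {M : ℝ}
    (hM : ∀ t, ‖φ t‖ ≤ M) (hP : Continuous P) (hP0 : ∀ t, P t = (‖P t‖ : ℂ)) {T : ℝ} (hT : 0 < T) :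
    ‖symmMean (fun t => φ t * P t) T‖ ≤ M * ‖symmMean P T‖ := by
  have h1 : ‖∫ t in -T..T, φ t * P t‖ ≤ ∫ t in -T..T, M * ‖P t‖ := by
    refine intervalIntegral.norm_integral_le_of_norm_le (by linarith) ?_
      (Continuous.intervalIntegrable (by fun_prop) _ _)
    refine Eventually.of_forall fun t _ => ?_
    rw [norm_mul]
    gcongr
    exact hM t
  have h2 : ‖∫ t in -T..T, P t‖ = ∫ t in -T..T, ‖P t‖ := by
    rw [intervalIntegral.integral_congr (g := fun t => ((‖P t‖ : ℝ) : ℂ)) fun t _ => hP0 t,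
      intervalIntegral.integral_ofReal, Complex.norm_real, Real.norm_of_nonneg]
    exact intervalIntegral.integral_nonneg (by linarith) fun t _ => norm_nonneg _
  rw [intervalIntegral.integral_const_mul, ← h2] at h1
  rw [symmMean, symmMean, norm_mul, norm_mul, mul_left_comm]
  gcongr

/-- A bounded function with Bohr coefficients `A` defines a bounded Toeplitz-type form. -/
theorem norm_sum_coeff_le {ι : Type*} {φ : ℝ → ℂ} (hφ : Continuous φ) {M : ℝ}
    (hM : ∀ t, ‖φ t‖ ≤ M) (S : Finset ι) {μ : ι → ℝ} (hμ : Function.Injective μ) (θ : ι → ℝ)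
    {A : ι → ι → ℂ}
    (hA : ∀ i ∈ S, ∀ j ∈ S,
      Tendsto (symmMean fun t => φ t * Complex.exp (Complex.I * (μ i - μ j : ℝ) * t)) atTop
        (𝓝 (A i j))) :
    ‖∑ i ∈ S, ∑ j ∈ S, Complex.exp (Complex.I * (θ i - θ j : ℝ)) * A i j‖ ≤ M * S.card := by
  classical
  -- `P` = |Q|² is nonnegative; as the frequencies are distinct, only the diagonal terms survive in
  -- its mean, which is `S.card`.
  set Q : ℝ → ℂ := fun t => ∑ i ∈ S, Complex.exp (Complex.I * (θ i + μ i * t : ℝ)) with hQ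
  set P : ℝ → ℂ := fun t => Q t * (starRingEnd ℂ) (Q t) with hP
  have hPsum : ∀ t, P t = ∑ i ∈ S, ∑ j ∈ S, Complex.exp (Complex.I * (θ i - θ j : ℝ)) *
      Complex.exp (Complex.I * (μ i - μ j : ℝ) * t) := by
    intro t
    simp only [hP, hQ, map_sum, Finset.sum_mul_sum]
    refine Finset.sum_congr rfl fun i _ => Finset.sum_congr rfl fun j _ => ?_
    rw [← Complex.exp_conj, ← Complex.exp_add, ← Complex.exp_add]
    congr 1
    simp only [map_mul, Complex.conj_I, Complex.conj_ofReal]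
    push_cast
    ring
  have hPc : Continuous P := by
    rw [funext hPsum]; fun_prop
  have hP0 : ∀ t, P t = (‖P t‖ : ℂ) := by
    intro t
    simp only [hP, Complex.mul_conj, Complex.norm_real]
    rw [Real.norm_of_nonneg (Complex.normSq_nonneg _)]
  have hleft : Tendsto (symmMean fun t => φ t * P t) atTop
      (𝓝 (∑ i ∈ S, ∑ j ∈ S, Complex.exp (Complex.I * (θ i - θ j : ℝ)) * A i j)) := by
    have heq : (symmMean fun t => φ t * P t) = fun T => ∑ i ∈ S, ∑ j ∈ S,
        Complex.exp (Complex.I * (θ i - θ j : ℝ)) *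
          symmMean (fun t => φ t * Complex.exp (Complex.I * (μ i - μ j : ℝ) * t)) T := by
      funext T
      have : (fun t => φ t * P t) = fun t => ∑ i ∈ S, ∑ j ∈ S,
          Complex.exp (Complex.I * (θ i - θ j : ℝ)) *
            (φ t * Complex.exp (Complex.I * (μ i - μ j : ℝ) * t)) := by
        funext t
        simp only [hPsum, Finset.mul_sum]
        refine Finset.sum_congr rfl fun i _ => Finset.sum_congr rfl fun j _ => ?_
        ring
      rw [this, symmMean_sum _ fun i => by fun_prop]
      refine Finset.sum_congr rfl fun i _ => ?_
      rw [symmMean_sum _ fun j => by fun_prop]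
      simp only [symmMean_const_mul]
    rw [heq]
    exact tendsto_finsetSum _ fun i hi => tendsto_finsetSum _ fun j hj =>
      (hA i hi j hj).const_mul _
  have hright : Tendsto (symmMean P) atTop (𝓝 (S.card : ℂ)) := by
    have heq : symmMean P = fun T => ∑ i ∈ S, ∑ j ∈ S,
        Complex.exp (Complex.I * (θ i - θ j : ℝ)) *
          symmMean (fun t => Complex.exp (Complex.I * (μ i - μ j : ℝ) * t)) T := by
      funext T
      rw [funext hPsum, symmMean_sum _ fun i => by fun_prop]
      refine Finset.sum_congr rfl fun i _ => ?_
      rw [symmMean_sum _ fun j => by fun_prop]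
      simp only [symmMean_const_mul]
    rw [heq]
    have hlim := tendsto_finsetSum S fun i _ => tendsto_finsetSum S fun j _ =>
      (tendsto_symmMean_exp (μ i - μ j)).const_mul (Complex.exp (Complex.I * (θ i - θ j : ℝ)))
    convert hlim using 2
    have : ∀ i ∈ S, ∑ j ∈ S, Complex.exp (Complex.I * (θ i - θ j : ℝ)) *
        (if μ i - μ j = 0 then 1 else 0) = 1 := by
      intro i hi
      rw [Finset.sum_eq_single i]
      · simp
      · intro j _ hj
        rw [if_neg, mul_zero]
        rw [sub_eq_zero]
        exact fun h => hj (hμ h).symm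
      · exact fun h => absurd hi h
    rw [Finset.sum_congr rfl this]
    simp
  have hfin := le_of_tendsto_of_tendsto hleft.norm (hright.norm.const_mul M)
    (by filter_upwards [eventually_gt_atTop 0] with T hT using
      norm_symmMean_mul_le hM hPc hP0 hT)
  simpa using hfin

/-! ### Counting in the cube and the ℓ₁ bound -/

/-- Every point of the cube with n-th coordinate below `K` may be raised by one there. The
proportion K/(K+1) of such points tends to 1. -/
theorem le_card_filter_add_single_mem {N K n : ℕ} (hn : n ∈ Finset.range N) :
    K * (K + 1) ^ (N - 1) ≤
      (((Finset.range N).finsupp fun _ => Finset.range (K + 1)).filter fun J =>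
        J + Finsupp.single n 1 ∈ (Finset.range N).finsupp fun _ => Finset.range (K + 1)).card := by
  have hcard : ((Finset.range N).finsupp
      (Function.update (fun _ => Finset.range (K + 1)) n (Finset.range K))).card =
      K * (K + 1) ^ (N - 1) := by
    rw [Finset.card_finsupp]
    have : ∀ i, (Function.update (fun _ => Finset.range (K + 1)) n (Finset.range K) i).card =
        Function.update (fun _ => K + 1) n K i := by
      intro i
      by_cases h : i = n
      · subst h; simp
      · simp [h]
    simp only [this]
    rw [Finset.prod_update_of_mem hn, Finset.prod_const,
      Finset.card_sdiff_of_subset (by simpa using hn)]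
    simp
  rw [← hcard]
  refine Finset.card_le_card fun J hJ => ?_
  rw [Finset.mem_finsupp_iff] at hJ
  obtain ⟨h1, h2⟩ := hJ
  have h3 : ∀ i ∈ Finset.range N, J i + Finsupp.single n 1 i < K + 1 := by
    intro i hi
    have := h2 i hi
    by_cases h : i = n
    · subst h
      simpa using this
    · simpa [h, Finsupp.single_apply, Ne.symm h] using this
  rw [Finset.mem_filter, Finset.mem_finsupp_iff, Finset.mem_finsupp_iff]
  refine ⟨⟨h1, fun i hi => Finset.mem_range.2 (lt_of_le_of_lt (Nat.le_add_right _ _) (h3 i hi))⟩,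
    ?_, fun i hi => Finset.mem_range.2 (h3 i hi)⟩
  refine Finsupp.support_add.trans (Finset.union_subset h1 ?_)
  exact Finsupp.support_single_subset.trans (by simpa using hn)

/-- For a `ℚ`-linearly independent frequency the coefficients of a series with bounded extension
are absolutely summable along every vertical line. -/
theorem IsBoundedExtension.sum_norm_mul_exp_le {lam : ℕ → ℝ} (hlam : IsFrequency lam)
    (hind : LinearIndependent ℚ lam) {a : ℕ → ℂ} {f : ℂ → ℂ} (hf : IsBoundedExtension lam a f)
    {s₀ : ℂ} (hs₀ : ConvergesAt lam a s₀) {M : ℝ} (hM : ∀ s ∈ halfPlane 0, ‖f s‖ ≤ M)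
    {σ : ℝ} (hσ : 0 < σ) (N : ℕ) :
    ∑ n ∈ Finset.range N, ‖a n‖ * Real.exp (-lam n * σ) ≤ M := by
  classical
  have hindN : Function.Injective (Finsupp.linearCombination ℕ lam) :=
    hind.restrict_scalars (R := ℕ) (by
      intro m n h
      simpa using h)
  set L := Finsupp.linearCombination ℕ lam with hL
  -- Additive phases: passing from j to j + e_n multiplies by e^{-i arg a_n}, which turns a_n into
  -- its modulus.
  set Θ := Finsupp.linearCombination ℕ fun n => -(a n).arg with hΘ
  set X := ∑ n ∈ Finset.range N, ‖a n‖ * Real.exp (-lam n * σ) with hX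
  have hphase : ∀ n, Complex.exp (Complex.I * (-(a n).arg : ℝ)) * a n = ‖a n‖ := by
    intro n
    conv_lhs => rw [← Complex.norm_mul_exp_arg_mul_I (a n)]
    rw [mul_left_comm, ← Complex.exp_add]
    simp only [Complex.norm_mul_exp_arg_mul_I]
    push_cast
    ring_nf
    simp
  have hφ := continuous_vertical hf.holomorphic hσ
  have hφM : ∀ t : ℝ, ‖f (σ + t * Complex.I)‖ ≤ M := fun t =>
    hM _ (by simpa [halfPlane] using hσ)
  have hM0 : 0 ≤ M := (norm_nonneg _).trans (hφM 0)
  have hK : ∀ K : ℕ, K * X ≤ M * (K + 1) := by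
    intro K
    set S := (Finset.range N).finsupp fun _ => Finset.range (K + 1) with hS
    -- Beyond every difference of frequencies, so that one `N'` serves all Bohr coefficients; `N ≤
    -- N'` retains the terms to be estimated.
    obtain ⟨N', hN', hNN'⟩ : ∃ N', (∀ i ∈ S, ∀ j ∈ S, L i - L j < lam N') ∧ N ≤ N' := by
      refine (Eventually.and ?_ (eventually_ge_atTop N)).exists
      rw [eventually_all_finset]
      intro i _
      rw [eventually_all_finset]
      intro j _
      exact hlam.tendsto.eventually_gt_atTop _
    have hmain := norm_sum_coeff_le hφ hφM S hindN Θ (A := fun i j =>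
      ∑ n ∈ Finset.range N', if i = j + Finsupp.single n 1 then
        a n * (Real.exp (-lam n * σ) : ℂ) else 0) (by
        intro i hi j hj
        -- This is where independence enters: λ_n is a difference of two frequencies only in the
        -- obvious way.
        have hiff : ∀ n, i = j + Finsupp.single n 1 ↔ lam n = L i - L j := by
          intro n
          rw [← hindN.eq_iff, map_add, Finsupp.linearCombination_single, one_smul]
          constructor <;> intro h <;> linarith
        simp only [hiff]
        exact hf.tendsto_symmMean hlam hs₀ hσ (hN' i hi j hj))
    have hcoef : ∑ i ∈ S, ∑ j ∈ S, Complex.exp (Complex.I * (Θ i - Θ j : ℝ)) *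
        (∑ n ∈ Finset.range N', if i = j + Finsupp.single n 1 then
          a n * (Real.exp (-lam n * σ) : ℂ) else 0) =
        ((∑ n ∈ Finset.range N', (S.filter fun j => j + Finsupp.single n 1 ∈ S).card *
          (‖a n‖ * Real.exp (-lam n * σ)) : ℝ) : ℂ) := by
      have h1 : ∀ i j : ℕ →₀ ℕ, ∀ n, Complex.exp (Complex.I * (Θ i - Θ j : ℝ)) *
          (if i = j + Finsupp.single n 1 then a n * (Real.exp (-lam n * σ) : ℂ) else 0) =
          if i = j + Finsupp.single n 1 then ((‖a n‖ * Real.exp (-lam n * σ) : ℝ) : ℂ)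
            else 0 := by
        intro i j n
        split_ifs with h
        · have : Θ i - Θ j = -(a n).arg := by
            rw [h, map_add, Finsupp.linearCombination_single, one_smul]; ring
          rw [this, ← mul_assoc, hphase]
          push_cast
          rfl
        · rw [mul_zero]
      simp only [Finset.mul_sum, h1]
      rw [Finset.sum_comm]
      calc _ = ∑ j ∈ S, ∑ n ∈ Finset.range N', if j + Finsupp.single n 1 ∈ S then
            ((‖a n‖ * Real.exp (-lam n * σ) : ℝ) : ℂ) else 0 := by
            refine Finset.sum_congr rfl fun j _ => ?_
            rw [Finset.sum_comm]
            exact Finset.sum_congr rfl fun n _ => Finset.sum_ite_eq' _ _ _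
        _ = _ := by
            rw [Finset.sum_comm, Complex.ofReal_sum]
            refine Finset.sum_congr rfl fun n _ => ?_
            rw [← Finset.sum_filter, Finset.sum_const, nsmul_eq_mul]
            push_cast
            rfl
    have hScard : S.card = (K + 1) ^ N := by
      rw [hS, Finset.card_finsupp]
      simp
    rw [hcoef, Complex.norm_real, hScard] at hmain
    have hlow : (K : ℝ) * (K + 1) ^ (N - 1) * X ≤ M * (K + 1) ^ N := by
      calc (K : ℝ) * (K + 1) ^ (N - 1) * X = ∑ n ∈ Finset.range N,
            (K : ℝ) * (K + 1) ^ (N - 1) * (‖a n‖ * Real.exp (-lam n * σ)) := by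
            rw [hX, Finset.mul_sum]
        _ ≤ ∑ n ∈ Finset.range N, (S.filter fun j => j + Finsupp.single n 1 ∈ S).card *
            (‖a n‖ * Real.exp (-lam n * σ)) := by
            refine Finset.sum_le_sum fun n hn => ?_
            gcongr
            exact_mod_cast le_card_filter_add_single_mem hn
        _ ≤ ∑ n ∈ Finset.range N', (S.filter fun j => j + Finsupp.single n 1 ∈ S).card *
            (‖a n‖ * Real.exp (-lam n * σ)) :=
            Finset.sum_le_sum_of_subset_of_nonneg (Finset.range_subset_range.2 hNN')
              fun _ _ _ => by positivity
        _ ≤ _ := le_abs_self _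
        _ ≤ _ := by simpa using hmain
    -- The truncated exponent `N - 1` is off for `N = 0`, where `X` is an empty sum.
    rcases Nat.eq_zero_or_pos N with h0 | h0
    · have : X = 0 := by simp [hX, h0]
      rw [this, mul_zero]
      positivity
    · have hpow : ((K : ℝ) + 1) ^ N = (K + 1) ^ (N - 1) * (K + 1) := by
        rw [← pow_succ, Nat.sub_add_cancel h0]
      rw [hpow] at hlow
      have hp : (0 : ℝ) < (K + 1) ^ (N - 1) := by positivity
      refine le_of_mul_le_mul_left ?_ hp
      linarith
  -- If `X` > `M`, then K(X - M) ≤ M fails for large K.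
  by_contra! hlt
  obtain ⟨K, hK'⟩ := exists_nat_gt (M / (X - M))
  rw [div_lt_iff₀ (by linarith)] at hK'
  linarith [hK K]

/-- The bound `M` does not depend on σ, so σ → 0⁺ in a finite sum suffices. -/
theorem IsBoundedExtension.sum_norm_le {lam : ℕ → ℝ} (hlam : IsFrequency lam)
    (hind : LinearIndependent ℚ lam) {a : ℕ → ℂ} {f : ℂ → ℂ} (hf : IsBoundedExtension lam a f)
    {s₀ : ℂ} (hs₀ : ConvergesAt lam a s₀) {M : ℝ} (hM : ∀ s ∈ halfPlane 0, ‖f s‖ ≤ M) (N : ℕ) :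
    ∑ n ∈ Finset.range N, ‖a n‖ ≤ M := by
  have hc : Continuous fun σ : ℝ => ∑ n ∈ Finset.range N, ‖a n‖ * Real.exp (-lam n * σ) := by
    fun_prop
  have hlim := (hc.tendsto 0).mono_left (nhdsWithin_le_nhds (s := Set.Ioi 0))
  simp only [mul_zero, Real.exp_zero, mul_one] at hlim
  refine le_of_tendsto hlim ?_
  filter_upwards [self_mem_nhdsWithin] with σ hσ
  exact hf.sum_norm_mul_exp_le hlam hind hs₀ hM hσ N

/-! ### Comparison of norms and of the spaces -/

theorem supNorm_partialSum_le {lam : ℕ → ℝ} (hlam : IsFrequency lam) (a : ℕ → ℂ) (N : ℕ) :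
    supNorm (partialSum lam a N) ≤ ∑' n, ‖a n‖ₑ := by
  refine iSup₂_le fun s hs => ?_
  refine (enorm_sum_le _ _).trans ((Finset.sum_le_sum fun n _ => ?_).trans
    (ENNReal.sum_le_tsum (Finset.range N)))
  exact enorm_le_iff_norm_le.2 (norm_term_le hlam a n hs)

theorem supNorm_le_iSup_partialSum {lam : ℕ → ℝ} {a : ℕ → ℂ} {f : ℂ → ℂ}
    (h : ∀ s ∈ halfPlane 0, Tendsto (fun N => partialSum lam a N s) atTop (𝓝 (f s))) :
    supNorm f ≤ ⨆ N, supNorm (partialSum lam a N) := by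
  refine iSup₂_le fun s hs => le_of_tendsto (h s hs).enorm (Eventually.of_forall fun N => ?_)
  exact (le_iSup₂ (f := fun s (_ : s ∈ halfPlane 0) => ‖partialSum lam a N s‖ₑ) s hs).trans
    (le_iSup (fun N => supNorm (partialSum lam a N)) N)

theorem tendsto_partialSum_of_summable {lam : ℕ → ℝ} (hlam : IsFrequency lam) {a : ℕ → ℂ}
    (ha : Summable fun n => ‖a n‖) :
    TendstoUniformlyOn (partialSum lam a)
      (fun s => ∑' n, a n * Complex.exp (-(lam n : ℂ) * s)) atTop (halfPlane 0) :=
  tendstoUniformlyOn_tsum_nat ha fun n _ hs => norm_term_le hlam a n hs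

theorem mem_DInf_of_summable {lam : ℕ → ℝ} (hlam : IsFrequency lam) {a : ℕ → ℂ}
    (ha : Summable fun n => ‖a n‖) : a ∈ DInf lam :=
  ⟨∑' n, ‖a n‖, fun _ hs => ⟨_, (tendsto_partialSum_of_summable hlam ha).tendsto_at hs,
    tsum_of_norm_bounded ha.hasSum fun n => norm_term_le hlam a n hs⟩⟩

/-- The pointwise limit is itself the extension, holomorphic by locally uniform convergence. -/
theorem DInf_subset_DInfExt {lam : ℕ → ℝ} (hlam : IsFrequency lam) :
    DInf lam ⊆ DInfExt lam := by
  rintro a ⟨C, hC⟩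
  choose! f hf hfC using hC
  exact ⟨⟨1, f 1, hf 1 (by simp [halfPlane])⟩, f, differentiableOn_of_tendsto hlam hf, ⟨C, hfC⟩,
    fun s hs _ => hf s hs⟩

theorem IsBoundedExtension.summable {lam : ℕ → ℝ} (hlam : IsFrequency lam)
    (hind : LinearIndependent ℚ lam) {a : ℕ → ℂ} {f : ℂ → ℂ} (hf : IsBoundedExtension lam a f)
    {s₀ : ℂ} (hs₀ : ConvergesAt lam a s₀) : Summable fun n => ‖a n‖ := by
  obtain ⟨C, hC⟩ := hf.bounded
  exact summable_of_sum_range_le (fun _ => norm_nonneg _) (hf.sum_norm_le hlam hind hs₀ hC)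

/-- Absolute convergence forces `sigmaC lam a ≤ 0`, so the extension is the sum on the whole
half-plane. -/
theorem IsBoundedExtension.tendsto_of_summable {lam : ℕ → ℝ} (hlam : IsFrequency lam)
    {a : ℕ → ℂ} {f : ℂ → ℂ} (hf : IsBoundedExtension lam a f) (ha : Summable fun n => ‖a n‖)
    {s : ℂ} (hs : s ∈ halfPlane 0) :
    Tendsto (fun N => partialSum lam a N s) atTop (𝓝 (f s)) := by
  refine hf.extends_limit s hs (lt_of_le_of_lt (b := ((0 : ℝ) : EReal)) (sInf_le ⟨0, rfl, ?_⟩)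
    (by exact_mod_cast hs))
  exact fun s hs => ⟨_, (tendsto_partialSum_of_summable hlam ha).tendsto_at hs⟩

theorem IsBoundedExtension.supNorm_eq {lam : ℕ → ℝ} (hlam : IsFrequency lam)
    (hind : LinearIndependent ℚ lam) {a : ℕ → ℂ} {f : ℂ → ℂ} (hf : IsBoundedExtension lam a f)
    {s₀ : ℂ} (hs₀ : ConvergesAt lam a s₀) : supNorm f = ∑' n, ‖a n‖ₑ := by
  refine le_antisymm ((supNorm_le_iSup_partialSum fun s hs => hf.tendsto_of_summable hlam
    (hf.summable hlam hind hs₀) hs).trans (iSup_le fun N => supNorm_partialSum_le hlam a N)) ?_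
  obtain ⟨C, hC⟩ := hf.bounded
  have hfin : supNorm f ≠ ∞ := by
    refine ne_top_of_le_ne_top (ENNReal.ofReal_ne_top (r := C)) (iSup₂_le fun s hs => ?_)
    rw [← ofReal_norm]
    exact ENNReal.ofReal_le_ofReal (hC s hs)
  have hM : ∀ s ∈ halfPlane 0, ‖f s‖ ≤ (supNorm f).toReal := by
    intro s hs
    rw [← toReal_enorm]
    exact ENNReal.toReal_mono hfin
      (le_iSup₂ (f := fun z (_ : z ∈ halfPlane 0) => ‖f z‖ₑ) s hs)
  rw [ENNReal.tsum_eq_iSup_nat]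
  refine iSup_le fun N => ?_
  rw [← ENNReal.ofReal_toReal hfin]
  refine le_trans (le_of_eq ?_) (ENNReal.ofReal_le_ofReal (hf.sum_norm_le hlam hind hs₀ hM N))
  rw [ENNReal.ofReal_sum_of_nonneg fun _ _ => norm_nonneg _]
  simp only [ofReal_norm]

/-- Every extension has sup norm Σ|a_n|, so the supremum over extensions is harmless without
invoking uniqueness. -/
theorem seriesNorm_eq {lam : ℕ → ℝ} (hlam : IsFrequency lam) (hind : LinearIndependent ℚ lam)
    {a : ℕ → ℂ} (ha : a ∈ DInfExt lam) : seriesNorm lam a = ∑' n, ‖a n‖ₑ := by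
  obtain ⟨⟨s₀, hs₀⟩, f, hf⟩ := ha
  refine le_antisymm (iSup₂_le fun g hg => (hg.supNorm_eq hlam hind hs₀).le) ?_
  rw [← hf.supNorm_eq hlam hind hs₀]
  exact le_iSup₂ (f := fun f (_ : IsBoundedExtension lam a f) => supNorm f) f hf

theorem summable_of_mem_DInfExt {lam : ℕ → ℝ} (hlam : IsFrequency lam)
    (hind : LinearIndependent ℚ lam) {a : ℕ → ℂ} (ha : a ∈ DInfExt lam) :
    Summable fun n => ‖a n‖ := by
  obtain ⟨⟨s₀, hs₀⟩, f, hf⟩ := ha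
  exact hf.summable hlam hind hs₀

/-! ### The sequence space ℓ₁ and the main theorem -/

theorem memℓp_one_iff_summable_norm {a : ℕ → ℂ} : Memℓp a 1 ↔ Summable fun n => ‖a n‖ := by
  simp [memℓp_gen_iff (p := 1) (E := fun _ : ℕ => ℂ) (by simp)]

theorem enorm_lp_one_eq_tsum (x : lp (fun _ : ℕ => ℂ) 1) : ‖x‖ₑ = ∑' n, ‖x n‖ₑ := by
  have hs : Summable fun n => ‖x n‖ := memℓp_one_iff_summable_norm.1 (lp.memℓp x)
  have h : ‖x‖ = ∑' n, ‖x n‖ := by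
    rw [lp.norm_eq_tsum_rpow (by simp)]
    simp
  rw [← ofReal_norm, h, ENNReal.ofReal_tsum_of_nonneg (fun _ => norm_nonneg _) hs]
  simp only [ofReal_norm]

end GenDirichlet

open GenDirichlet in
theorem theorem4p7 (lam : ℕ → ℝ) (hlam : IsFrequency lam) (hind : LinearIndependent ℚ lam) :
    -- coefficients are absolutely summable, with `ℓ₁`-norm equal to the norm of the series
    (∀ a ∈ DInfExt lam, Memℓp a 1 ∧ (∑' n, ‖a n‖ₑ) = seriesNorm lam a ∧
      ∀ f : ℂ → ℂ, IsBoundedExtension lam a f → supNorm f = seriesNorm lam a) ∧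
    -- both spaces are the isometric image of `ℓ₁` under the identification with coefficients
    DInfExt lam = DInf lam ∧
    (∃ Φ : lp (fun _ : ℕ => ℂ) 1 →ₗ[ℂ] (ℕ → ℂ),
      (∀ x n, Φ x n = x n) ∧ Set.range Φ = DInfExt lam ∧ Set.range Φ = DInf lam ∧
      ∀ x, seriesNorm lam (Φ x) = ‖x‖ₑ) ∧
    SatisfiesBohr lam ∧
    ∀ a ∈ DInfExt lam, (⨆ N : ℕ, supNorm (partialSum lam a N)) = seriesNorm lam a := by
  have hsum := fun a (ha : a ∈ DInfExt lam) => summable_of_mem_DInfExt hlam hind ha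
  have heq : DInfExt lam = DInf lam :=
    Set.Subset.antisymm (fun a ha => mem_DInf_of_summable hlam (hsum a ha))
      (DInf_subset_DInfExt hlam)
  have hmem : ∀ x : lp (fun _ : ℕ => ℂ) 1, (fun n => x n) ∈ DInfExt lam := fun x =>
    DInf_subset_DInfExt hlam
      (mem_DInf_of_summable hlam (memℓp_one_iff_summable_norm.1 (lp.memℓp x)))
  refine ⟨fun a ha => ⟨memℓp_one_iff_summable_norm.2 (hsum a ha),
    (seriesNorm_eq hlam hind ha).symm, fun f hf => ?_⟩, heq, ?_, ?_, ?_⟩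
  · obtain ⟨s₀, hs₀⟩ := ha.1
    rw [seriesNorm_eq hlam hind ha, hf.supNorm_eq hlam hind hs₀]
  · let Φ : lp (fun _ : ℕ => ℂ) 1 →ₗ[ℂ] (ℕ → ℂ) :=
      { toFun := fun x n => x n
        map_add' := fun _ _ => rfl
        map_smul' := fun _ _ => rfl }
    have hrange : Set.range Φ = DInfExt lam := by
      refine Set.Subset.antisymm ?_ fun a ha => ?_
      · rintro _ ⟨x, rfl⟩
        exact hmem x
      · exact ⟨⟨a, memℓp_one_iff_summable_norm.2 (hsum a ha)⟩, rfl⟩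
    refine ⟨Φ, fun _ _ => rfl, hrange, hrange.trans heq, fun x => ?_⟩
    rw [enorm_lp_one_eq_tsum]
    exact seriesNorm_eq hlam hind (hmem x)
  · intro a ha ε hε
    exact ⟨_, (tendsto_partialSum_of_summable hlam (hsum a ha)).mono fun s hs =>
      hε.trans hs⟩
  · intro a ha
    refine le_antisymm ?_ ?_
    · rw [seriesNorm_eq hlam hind ha]
      exact iSup_le fun N => supNorm_partialSum_le hlam a N
    · exact iSup₂_le fun f hf => supNorm_le_iSup_partialSum fun s hs =>
        hf.tendsto_of_summable hlam (hsum a ha) hs
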